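/- Let $a,b,c,\mu\in\mathbb C$ with $a+b=c+b=-\tfrac14$ and $\mu\neq0$, let $\lambda_1,\lambda_2,\lambda_3\in\mathbb C$ with $\lambda_1+\lambda_2+\lambda_3=0$, and let $S$ be a constant traceless $2\times2$ complex matrix. Let $U\subset\mathbb C$ be a connected open neighbourhood of $t_0$, and let $x_1,x_2,x_3:U\to\mathbb C$ be holomorphic functions with pairwise distinct values $x_1(t),x_2(t),x_3(t)$ for each $t\in U$, solving Halphen's second equation (the generic form of the Darboux–Halphen V system) $$x_i'=Q(x_i),\qquad Q(x)=x^2+a(x_1-x_2)^2+b(x_2-x_3)^2+c(x_3-x_1)^2 .$$ Put $P(x)=(x-x_1)(x-x_2)(x-x_3)$. Let $V$ be an open neighbourhood of a base point $x_0\in\mathbb C$ with $x_i(t)\notin V$ for all $i$ and all $t\in U$, let $\nu(t,x)$ be a function on $U\times V$ with $\partial\nu/\partial x=-\mu\,(x+x_1+x_2+x_3)/P$, and let $Y(t,x)$, $(t,x)\in U\times V$, be a fundamental (invertible $2\times2$ matrix) solution of the Lax pair $$\frac{\partial Y}{\partial x}=\Big(\frac{\mu}{P}I+\sum_{i=1}^3\frac{\lambda_iS}{x-x_i}\Big)Y,\qquad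 \frac{\partial Y}{\partial t}=\Big(\nu I+\sum_{i=1}^3\lambda_ix_iS\Big)Y-Q(x)\frac{\partial Y}{\partial x}.$$ Let $\alpha_i(t)$ be the residues determined by $\dfrac{x+x_1+x_2+x_3}{P(x)}=\sum_{i=1}^3\dfrac{\alpha_i}{x-x_i}$. For $t\in U$, an elementary loop around $x_i(t)$ is a loop based at $x_0$ in $\mathbb C\setminus\{x_1(t),x_2(t),x_3(t)\}$ which is freely homotopic there to a small positively oriented circle around $x_i(t)$. The monodromy matrix of $Y(t,\cdot)$ along a loop based at $x_0$ is the matrix $M$ such that analytic continuation of $Y(t,\cdot)$ along the loop ends with $Y(t,\cdot)M$. Then there are constant matrices $G_1,G_2,G_3\in \mathrm{GL}_2(\mathbb C)$ and holomorphic functions $c_1,c_2,c_3$ on $U$ such that $$c_i(t)=\exp\Big(-2\pi\sqrt{-1}\,\mu\int_{t_0}^t\alpha_i\,dt\Big)$$ (the integral being taken along any $C^1$ path from $t_0$ to $t$ in $U$) and such that, for every $t\in U$ and every elementary loop around $x_i(t)$, the monodromy matrix of $Y(t,\cdot)$ along that loop exists, is unique, and equals $$M_i(t)=c_i(t)\,G_i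 .$$ In particular the first equation of the Lax pair is projectively isomonodromic: for every finite family $\gamma_1,\dots,\gamma_m$ of loops based at $x_0$ which avoid $x_1(t),x_2(t),x_3(t)$ for all $t\in U$ (for instance generators of the fundamental group of a domain free of the moving singular points), there are nowhere vanishing holomorphic functions $\tilde c_1,\dots,\tilde c_m$ on $U$ and constant matrices $\tilde G_1,\dots,\tilde G_m\in\mathrm{GL}_2(\mathbb C)$ such that for each $t\in U$ some fundamental solution of that equation near $x_0$ has monodromy matrix $\tilde c_k(t)\tilde G_k$ along $\gamma_k$ for every $k$. -/

import Mathlib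

open Filter Topology

namespace DarbouxHalphen

noncomputable section

/-! ### Analytic continuation and monodromy -/

/-- `F` is an analytic continuation along the path `γ`: `F s` is (a representative of) the germ at
`γ s`; each germ is analytic, and the germs at nearby parameters are restrictions of one another. -/
structure IsAnalyticContinuation {n : ℕ} {x₀ x₁ : ℂ} (γ : Path x₀ x₁)
    (F : unitInterval → ℂ → Matrix (Fin n) (Fin n) ℂ) : Prop where
  analyticAt : ∀ s j k, AnalyticAt ℂ (fun z => F s z j k) (γ s)
  coherent : ∀ s, ∀ᶠ s' in 𝓝 s, F s' =ᶠ[𝓝 (γ s')] F s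

/-- `M` is the monodromy matrix of the (matrix valued) germ `Y` along the loop `γ` based at `x₀`:
the germ of `Y` at `x₀` can be continued analytically along `γ`, and the continuation
ends with the germ of `Y * M`. -/
def IsMonodromyMatrix {n : ℕ} {x₀ : ℂ} (Y : ℂ → Matrix (Fin n) (Fin n) ℂ) (γ : Path x₀ x₀)
    (M : Matrix (Fin n) (Fin n) ℂ) : Prop :=
  ∃ F : unitInterval → ℂ → Matrix (Fin n) (Fin n) ℂ,
    IsAnalyticContinuation γ F ∧ F 0 =ᶠ[𝓝 x₀] Y ∧ F 1 =ᶠ[𝓝 x₀] fun z => Y z * M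

/-- `γ` is an elementary loop around the point `p i`: inside `ℂ ∖ {p j}` it is freely homotopic
(through closed curves) to a positively oriented circle centred at `p i` whose closed disk
contains no other `p j`. Equivalently, `γ` is homotopic to a path running from the base point
to such a circle, followed by the circle, followed by the same path backwards. -/
def IsElementaryLoop {m : ℕ} (p : Fin m → ℂ) (i : Fin m) {x₀ : ℂ} (γ : Path x₀ x₀) : Prop :=
  ∃ r : ℝ, 0 < r ∧ (∀ j, j ≠ i → r < dist (p j) (p i)) ∧
    ∃ H : C(unitInterval × unitInterval, ℂ),
      (∀ u s j, H (u, s) ≠ p j) ∧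
      (∀ s, H (0, s) = γ s) ∧
      (∀ s : unitInterval,
        H (1, s) = p i + r * Complex.exp (2 * Real.pi * Complex.I * ((s : ℝ) : ℂ))) ∧
      (∀ u, H (u, 0) = H (u, 1))

/-- `Y` is a fundamental solution of the linear system `dY/dz = A(z) Y` near `x₀`. -/
def IsFundamentalSolutionNear {n : ℕ} (A : ℂ → Matrix (Fin n) (Fin n) ℂ) (x₀ : ℂ)
    (Y : ℂ → Matrix (Fin n) (Fin n) ℂ) : Prop :=
  ∀ᶠ z in 𝓝 x₀, IsUnit (Y z) ∧ ∀ j k, HasDerivAt (fun w => Y w j k) ((A z * Y z) j k) z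

/-- The parametrized linear system `dY/dz = A(t, z) Y`, `t ∈ P`, is projectively isomonodromic with
respect to the finite family of loops `γ` based at `x₀` (typically generators of the fundamental
group of a domain on which all the systems are holomorphic): there are nowhere vanishing
holomorphic functions `c k` on `P` and constant invertible matrices `G k` such that for each `t`
some fundamental solution near `x₀` has monodromy matrix `c k t • G k` along `γ k`,
for all `k` simultaneously. -/
def IsProjectivelyIsomonodromic {n m : ℕ} {E : Type*} [NormedAddCommGroup E] [NormedSpace ℂ E]
    (A : E → ℂ → Matrix (Fin n) (Fin n) ℂ) (P : Set E) {x₀ : ℂ} (γ : Fin m → Path x₀ x₀) : Prop :=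
  ∃ (c : Fin m → E → ℂ) (G : Fin m → GL (Fin n) ℂ),
    (∀ k, AnalyticOnNhd ℂ (c k) P ∧ ∀ t ∈ P, c k t ≠ 0) ∧
    ∀ t ∈ P, ∃ Y : ℂ → Matrix (Fin n) (Fin n) ℂ,
      IsFundamentalSolutionNear (A t) x₀ Y ∧
      ∀ k, IsMonodromyMatrix Y (γ k) (c k t • (G k : Matrix (Fin n) (Fin n) ℂ))

/-! ### The Lax pair

Below `p 0, p 1, p 2` stand for the values `x₁, x₂, x₃` at a given time. -/

/-- `P(z) = (z - x₁)(z - x₂)(z - x₃)`. -/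
def cubicP (p : Fin 3 → ℂ) (z : ℂ) : ℂ := ∏ i, (z - p i)

/-- `Q(z) = z² + a (x₁ - x₂)² + b (x₂ - x₃)² + c (x₃ - x₁)²`. -/
def quadQ (a b c : ℂ) (p : Fin 3 → ℂ) (z : ℂ) : ℂ :=
  z ^ 2 + a * (p 0 - p 1) ^ 2 + b * (p 1 - p 2) ^ 2 + c * (p 2 - p 0) ^ 2

/-- The functions `x i` solve Halphen's second equation `xᵢ' = Q(xᵢ)` on `U`. -/
def IsHalphenSolution (a b c : ℂ) (x : Fin 3 → ℂ → ℂ) (U : Set ℂ) : Prop :=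
  ∀ t ∈ U, ∀ i, HasDerivAt (x i) (quadQ a b c (fun j => x j t) (x i t)) t

/-- The coefficient `(μ / P(z)) I + ∑ λᵢ S / (z - xᵢ)` of the first equation of the Lax pair. -/
def laxA (μ : ℂ) (l : Fin 3 → ℂ) (S : Matrix (Fin 2) (Fin 2) ℂ) (p : Fin 3 → ℂ) (z : ℂ) :
    Matrix (Fin 2) (Fin 2) ℂ :=
  (μ / cubicP p z) • (1 : Matrix (Fin 2) (Fin 2) ℂ) + ∑ i, (l i / (z - p i)) • S

/-- The coefficient `ν I + ∑ λᵢ xᵢ S` in the second equation of the Lax pair,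
`ν` being the value of the auxiliary function. -/
def laxB (ν : ℂ) (l : Fin 3 → ℂ) (S : Matrix (Fin 2) (Fin 2) ℂ) (p : Fin 3 → ℂ) :
    Matrix (Fin 2) (Fin 2) ℂ :=
  ν • (1 : Matrix (Fin 2) (Fin 2) ℂ) + ∑ i, (l i * p i) • S

/-- `Y(t, z)` is, for `t ∈ U` and `z ∈ V`, a fundamental solution of the Lax pair
`∂Y/∂z = laxA Y`, `∂Y/∂t = laxB Y - Q(z) ∂Y/∂z`. -/
structure IsLaxFundamentalSolution (a b c μ : ℂ) (l : Fin 3 → ℂ) (S : Matrix (Fin 2) (Fin 2) ℂ)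
    (x : Fin 3 → ℂ → ℂ) (ν : ℂ → ℂ → ℂ) (U V : Set ℂ)
    (Y : ℂ → ℂ → Matrix (Fin 2) (Fin 2) ℂ) : Prop where
  isUnit : ∀ t ∈ U, ∀ z ∈ V, IsUnit (Y t z)
  deriv_z : ∀ t ∈ U, ∀ z ∈ V, ∀ j k,
    HasDerivAt (fun w => Y t w j k) ((laxA μ l S (fun i => x i t) z * Y t z) j k) z
  deriv_t : ∀ t ∈ U, ∀ z ∈ V, ∀ j k,
    HasDerivAt (fun s => Y s z j k)
      ((laxB (ν t z) l S (fun i => x i t) * Y t z) j k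
        - quadQ a b c (fun i => x i t) z * deriv (fun w => Y t w j k) z) t

end

end DarbouxHalphen

namespace DarbouxHalphen

/-! ### Winding numbers of closed curves -/

/-! Both coefficients of the Lax pair lie in the commutative algebra generated by `S`. Hence the
first equation is solved by `exp (g I + h S) K`, where `g` and `h` are combinations of the
logarithms `log (z - xᵢ)`. Continuation along a loop shifts each logarithm by `2πi` times a winding
number, so the monodromy is `Y(x₀)⁻¹ exp (G I + H S) Y(x₀)` with `G`, `H` read off from residues and
winding numbers (`isMonodromyMatrix_of_hasWinding`).

At the base point, `Y(t, x₀)` satisfies a linear equation in `t` whose coefficient commutes with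
`S`, so the conjugate of `exp (H S)` by `Y(t, x₀)` does not depend on `t` (`conj_eq_of_hasDerivAt`).
Only the scalar `exp G` moves, through the residues `rᵢ` of `1 / P`. Halphen's equation gives `rᵢ' =
-αᵢ` (`hasDerivAt_cubicResidue`, `residue_eq`), which turns this scalar into the exponential of the
integral of `αᵢ`. -/

theorem eq_of_exp_eq_of_norm_sub_lt {u v : ℂ} (h : Complex.exp u = Complex.exp v)
    (hn : ‖u - v‖ < 1) : u = v := by
  obtain ⟨n, hn'⟩ := Complex.exp_eq_exp_iff_exists_int.1 h
  rw [hn', add_sub_cancel_left, norm_mul] at hn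
  have h2 : ‖(2 * Real.pi * Complex.I : ℂ)‖ = 2 * Real.pi := by
    simp [abs_of_pos Real.pi_pos]
  rw [h2, Complex.norm_intCast] at hn
  have h0 : n = 0 := by
    by_contra h0
    have h1 : (1 : ℝ) ≤ |(n : ℝ)| := by exact_mod_cast Int.one_le_abs h0
    nlinarith [Real.pi_gt_three]
  simpa [h0] using hn'

theorem exists_continuous_log {f : unitInterval → ℂ} (hf : Continuous f) (h0 : ∀ s, f s ≠ 0) :
    ∃ θ : unitInterval → ℂ, Continuous θ ∧ ∀ s, Complex.exp (θ s) = f s := by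
  let f' : C(unitInterval, {z : ℂ // z ≠ 0}) := ⟨fun s => ⟨f s, h0 s⟩, by fun_prop⟩
  obtain ⟨Γ, hΓ, -⟩ := Complex.isCoveringMap_exp.exists_path_lifts f' (Complex.log (f 0))
    (Subtype.ext (Complex.exp_log (h0 0)).symm)
  exact ⟨Γ, Γ.continuous, fun s => congrArg Subtype.val (congrFun hΓ s)⟩

/-- `n` is the winding number around `0` of the closed curve `f`. -/
def HasWinding (f : unitInterval → ℂ) (n : ℤ) : Prop :=
  ∃ θ : unitInterval → ℂ, Continuous θ ∧ (∀ s, Complex.exp (θ s) = f s) ∧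
    θ 1 = θ 0 + n * (2 * Real.pi * Complex.I)

theorem exists_hasWinding {f : unitInterval → ℂ} (hf : Continuous f) (h0 : ∀ s, f s ≠ 0)
    (h01 : f 0 = f 1) : ∃ n, HasWinding f n := by
  obtain ⟨θ, hθ, he⟩ := exists_continuous_log hf h0
  obtain ⟨n, hn⟩ := Complex.exp_eq_exp_iff_exists_int.1 ((he 1).trans (h01.symm.trans (he 0).symm))
  exact ⟨n, θ, hθ, he, hn⟩

theorem HasWinding.unique {f : unitInterval → ℂ} {m n : ℤ} (hm : HasWinding f m)
    (hn : HasWinding f n) : m = n := by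
  obtain ⟨θ, hθ, he, h1⟩ := hm
  obtain ⟨η, hη, he', h1'⟩ := hn
  have hloc : IsLocallyConstant fun s => θ s - η s := by
    refine (IsLocallyConstant.iff_eventually_eq _).2 fun s => ?_
    have hc : Continuous fun s' => ‖(θ s' - η s') - (θ s - η s)‖ := by fun_prop
    filter_upwards [hc.continuousAt.eventually_lt (continuousAt_const (y := (1 : ℝ)))
      (by simp)] with s' hs'
    refine eq_of_exp_eq_of_norm_sub_lt ?_ hs'
    rw [Complex.exp_sub, Complex.exp_sub, he, he', he, he']
    rw [div_self, div_self]
    · rw [← he]; exact Complex.exp_ne_zero _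
    · rw [← he]; exact Complex.exp_ne_zero _
  have h := hloc.apply_eq_of_preconnectedSpace 0 1
  simp only [h1, h1'] at h
  have h2 : ((m : ℂ) - n) * (2 * Real.pi * Complex.I) = 0 := by linear_combination -h
  have h3 := (mul_eq_zero.1 h2).resolve_right Complex.two_pi_I_ne_zero
  exact_mod_cast sub_eq_zero.1 h3

/-- By compactness of the interval, `K t' s / K t s` stays in the slit plane for all `s` once `t'`
is near `t`. Its principal logarithm corrects `θ` and, the ratio being a closed curve, leaves the
increment unchanged. -/
theorem HasWinding.eventually {T : Type*} [TopologicalSpace T] {K : T → unitInterval → ℂ}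
    (hK : Continuous (Function.uncurry K)) (h0 : ∀ t s, K t s ≠ 0) (h01 : ∀ t, K t 0 = K t 1)
    {t : T} {n : ℤ} (h : HasWinding (K t) n) : ∀ᶠ t' in 𝓝 t, HasWinding (K t') n := by
  obtain ⟨θ, hθ, he, h1⟩ := h
  have hr : Continuous fun q : T × unitInterval => K q.1 q.2 / K t q.2 :=
    hK.div (hK.comp (continuous_const.prodMk continuous_snd)) fun q => h0 _ _
  have hev : ∀ᶠ t' in 𝓝 t, ∀ s ∈ (Set.univ : Set unitInterval),
      K t' s / K t s ∈ Complex.slitPlane := by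
    refine isCompact_univ.eventually_forall_of_forall_eventually fun s _ => ?_
    refine hr.continuousAt.eventually_mem (Complex.isOpen_slitPlane.mem_nhds ?_)
    simp [div_self (h0 t s)]
  filter_upwards [hev] with t' ht'
  refine ⟨fun s => θ s + Complex.log (K t' s / K t s), ?_, fun s => ?_, ?_⟩
  · have hr' : Continuous fun s => K t' s / K t s :=
      hr.comp (continuous_const.prodMk continuous_id)
    exact hθ.add (hr'.clog fun s => ht' s trivial)
  · rw [Complex.exp_add, he, Complex.exp_log (div_ne_zero (h0 _ _) (h0 _ _)),
      mul_div_cancel₀ _ (h0 _ _)]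
  · simp only [h1, ← h01]
    ring

/-- The winding numbers partition `T` into open sets. This serves twice: for free homotopies of a
loop, and for a fixed loop around a moving point. -/
theorem HasWinding.of_preconnected {T : Type*} [TopologicalSpace T] [PreconnectedSpace T]
    {K : T → unitInterval → ℂ}
    (hK : Continuous (Function.uncurry K)) (h0 : ∀ t s, K t s ≠ 0) (h01 : ∀ t, K t 0 = K t 1)
    {t : T} {n : ℤ} (h : HasWinding (K t) n) (t' : T) : HasWinding (K t') n := by
  have hopen : ∀ m, IsOpen {t | HasWinding (K t) m} := fun m =>
    isOpen_iff_mem_nhds.2 fun _ ht => HasWinding.eventually hK h0 h01 ht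
  have hclosed : IsClosed {t | HasWinding (K t) n} := by
    refine ⟨isOpen_iff_mem_nhds.2 fun u hu => ?_⟩
    obtain ⟨m, hm⟩ := exists_hasWinding (f := K u)
      (hK.comp (continuous_const.prodMk continuous_id)) (h0 u) (h01 u)
    filter_upwards [(hopen m).mem_nhds hm] with v hv hv'
    exact hu (by rw [Set.mem_ofPred_eq, ← HasWinding.unique hv hv']; exact hm)
  have := IsClopen.eq_univ ⟨hclosed, hopen n⟩ ⟨t, h⟩
  exact Set.eq_univ_iff_forall.1 this t'

theorem hasWinding_circle {r : ℝ} (hr : 0 < r) :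
    HasWinding (fun s => r * Complex.exp (2 * Real.pi * Complex.I * ((s : ℝ) : ℂ))) 1 := by
  refine ⟨fun s => Complex.log r + 2 * Real.pi * Complex.I * ((s : ℝ) : ℂ), by fun_prop,
    fun s => ?_, ?_⟩
  · rw [Complex.exp_add, Complex.exp_log (by exact_mod_cast hr.ne')]
  · simp

theorem hasWinding_circle_add {r : ℝ} (hr : 0 < r) {d : ℂ} (hd : r < ‖d‖) :
    HasWinding (fun s => d + r * Complex.exp (2 * Real.pi * Complex.I * ((s : ℝ) : ℂ))) 0 := by
  have hd0 : d ≠ 0 := norm_pos_iff.1 (hr.trans hd)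
  have hn : ∀ s : unitInterval,
      ‖r * Complex.exp (2 * Real.pi * Complex.I * ((s : ℝ) : ℂ)) / d‖ < 1 := fun s => by
    have : (2 * Real.pi * Complex.I * ((s : ℝ) : ℂ)) =
      ((2 * Real.pi * s : ℝ) : ℂ) * Complex.I := by push_cast; ring
    rw [this, norm_div, norm_mul, Complex.norm_exp_ofReal_mul_I, Complex.norm_real,
      Real.norm_of_nonneg hr.le, mul_one, div_lt_one (hr.trans hd)]
    exact hd
  have hm : ∀ s : unitInterval,
      1 + r * Complex.exp (2 * Real.pi * Complex.I * ((s : ℝ) : ℂ)) / d ∈ Complex.slitPlane :=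
    fun s => Complex.mem_slitPlane_of_norm_lt_one (hn s)
  refine ⟨fun s => Complex.log d +
    Complex.log (1 + r * Complex.exp (2 * Real.pi * Complex.I * ((s : ℝ) : ℂ)) / d),
    continuous_const.add (Continuous.clog (by fun_prop) hm), fun s => ?_, ?_⟩
  · rw [Complex.exp_add, Complex.exp_log hd0, Complex.exp_log (Complex.slitPlane_ne_zero (hm s))]
    field_simp
  · simp [Complex.exp_two_pi_mul_I]

theorem IsElementaryLoop.hasWinding {m : ℕ} {p : Fin m → ℂ} {i : Fin m} {x₀ : ℂ} {γ : Path x₀ x₀}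
    (h : IsElementaryLoop p i γ) (j : Fin m) :
    HasWinding (fun s => γ s - p j) (if j = i then 1 else 0) := by
  obtain ⟨r, hr, hd, H, hH, h0, h1, h01⟩ := h
  -- The winding number is computed on the circle, at the end `1` of the homotopy, and carried back
  -- to `γ` at `0`.
  have key := HasWinding.of_preconnected (K := fun u s => H (u, s) - p j) (t := 1)
    (n := if j = i then 1 else 0) (by unfold Function.uncurry; fun_prop)
    (fun u s => sub_ne_zero.2 (hH u s j))
    (fun u => by rw [h01]) ?_ 0
  · simpa only [h0] using key
  · simp only [h1]
    split_ifs with hji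
    · subst hji
      simpa using hasWinding_circle hr
    · have := hd j hji
      rw [dist_eq_norm, norm_sub_rev] at this
      convert hasWinding_circle_add hr this using 2
      ring

/-! ### Analytic continuation along a path -/

/-- The parameters at which the germs agree form a clopen set: open by coherence, closed by the
identity theorem on a ball around `γ s`. -/
theorem IsAnalyticContinuation.eventuallyEq_of_eventuallyEq_zero {n : ℕ} {x₀ x₁ : ℂ}
    {γ : Path x₀ x₁} {F F' : unitInterval → ℂ → Matrix (Fin n) (Fin n) ℂ}
    (hF : IsAnalyticContinuation γ F) (hF' : IsAnalyticContinuation γ F')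
    (h0 : F 0 =ᶠ[𝓝 x₀] F' 0) (s : unitInterval) : F s =ᶠ[𝓝 (γ s)] F' s := by
  have hopen : IsOpen {s | F s =ᶠ[𝓝 (γ s)] F' s} := by
    refine isOpen_iff_mem_nhds.2 fun s hs => ?_
    filter_upwards [hF.coherent s, hF'.coherent s,
      γ.continuous.continuousAt.eventually hs.eventually_nhds] with s' h1 h2 h3
    exact h1.trans (EventuallyEq.trans h3 h2.symm)
  have hclosed : IsClosed {s | F s =ᶠ[𝓝 (γ s)] F' s} := by
    refine isClosed_iff_frequently.2 fun s hs => ?_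
    have hev : ∀ᶠ z in 𝓝 (γ s), ∀ j k, AnalyticAt ℂ (fun z => F s z j k) z ∧
        AnalyticAt ℂ (fun z => F' s z j k) z := by
      simp only [eventually_all]
      exact fun j k => ((hF.analyticAt s j k).eventually_analyticAt).and
        (hF'.analyticAt s j k).eventually_analyticAt
    obtain ⟨ε, hε, hb⟩ := Metric.eventually_nhds_iff_ball.1 hev
    obtain ⟨s', hs', h1, h2, h3⟩ := (hs.and_eventually ((hF.coherent s).and
      ((hF'.coherent s).and (γ.continuous.continuousAt.eventually
        (Metric.ball_mem_nhds (γ s) hε))))).exists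
    have heq : F s =ᶠ[𝓝 (γ s')] F' s := h1.symm.trans (EventuallyEq.trans hs' h2)
    have hall : ∀ j k, Set.EqOn (fun z => F s z j k) (fun z => F' s z j k)
        (Metric.ball (γ s) ε) := fun j k =>
      AnalyticOnNhd.eqOn_of_preconnected_of_eventuallyEq (fun z hz => (hb z hz j k).1)
        (fun z hz => (hb z hz j k).2) (convex_ball _ _).isPreconnected h3
        (heq.mono fun z hz => by simp only [hz])
    filter_upwards [Metric.ball_mem_nhds (γ s) hε] with z hz
    ext j k
    exact hall j k hz
  have := IsClopen.eq_univ ⟨hclosed, hopen⟩ ⟨0, by simpa using h0⟩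
  exact Set.eq_univ_iff_forall.1 this s

theorem IsMonodromyMatrix.unique {n : ℕ} {x₀ : ℂ} {Y : ℂ → Matrix (Fin n) (Fin n) ℂ}
    {γ : Path x₀ x₀} {M M' : Matrix (Fin n) (Fin n) ℂ} (hY : IsUnit (Y x₀))
    (h : IsMonodromyMatrix Y γ M) (h' : IsMonodromyMatrix Y γ M') : M = M' := by
  obtain ⟨F, hF, h0, h1⟩ := h
  obtain ⟨F', hF', h0', h1'⟩ := h'
  have := hF.eventuallyEq_of_eventuallyEq_zero hF' (h0.trans h0'.symm) 1
  rw [γ.target] at this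
  exact hY.mul_left_cancel (h1.symm.trans (this.trans h1')).eq_of_nhds

/-- The branch of `log (z - p)` near `γ s` obtained by continuation along `γ`, where `θ` is a
continuous logarithm of `γ - p`. -/
noncomputable def logBranch {x₀ x₁ : ℂ} (γ : Path x₀ x₁) (p : ℂ) (θ : unitInterval → ℂ)
    (s : unitInterval) (z : ℂ) : ℂ :=
  θ s + Complex.log ((z - p) / (γ s - p))

section logBranch

variable {x₀ x₁ : ℂ} {γ : Path x₀ x₁} {p : ℂ} {θ : unitInterval → ℂ}

theorem exp_logBranch (he : ∀ s, Complex.exp (θ s) = γ s - p) (s : unitInterval) {z : ℂ}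
    (hz : z ≠ p) : Complex.exp (logBranch γ p θ s z) = z - p := by
  have h0 : γ s - p ≠ 0 := he s ▸ Complex.exp_ne_zero _
  rw [logBranch, Complex.exp_add, he, Complex.exp_log (div_ne_zero (sub_ne_zero.2 hz) h0),
    mul_div_cancel₀ _ h0]

theorem eventually_hasDerivAt_logBranch (s : unitInterval) (h0 : γ s ≠ p) :
    ∀ᶠ z in 𝓝 (γ s), HasDerivAt (logBranch γ p θ s) (1 / (z - p)) z := by
  have h0' := sub_ne_zero.2 h0
  have hc : ContinuousAt (fun z => (z - p) / (γ s - p)) (γ s) := by fun_prop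
  filter_upwards [hc.eventually_mem (Complex.isOpen_slitPlane.mem_nhds (by simp [div_self h0']))]
    with z hz
  have h1 : HasDerivAt (fun z => (z - p) / (γ s - p)) (1 / (γ s - p)) z :=
    ((hasDerivAt_id z).sub_const p).div_const _
  have h2 := (h1.clog hz).const_add (θ s)
  have hz0 : z - p ≠ 0 := fun h => Complex.slitPlane_ne_zero hz (by simp [h])
  convert! h2 using 1
  field_simp

theorem eventually_logBranch_eventuallyEq (hθ : Continuous θ)
    (he : ∀ s, Complex.exp (θ s) = γ s - p) (s : unitInterval) :
    ∀ᶠ s' in 𝓝 s, logBranch γ p θ s' =ᶠ[𝓝 (γ s')] logBranch γ p θ s := by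
  have hne : ∀ s, γ s ≠ p := fun s => sub_ne_zero.1 (he s ▸ Complex.exp_ne_zero _)
  have hself : ∀ s, logBranch γ p θ s (γ s) = θ s := fun s => by
    simp [logBranch, div_self (sub_ne_zero.2 (hne s))]
  -- Two branches have the same exponential, so it suffices that they differ by less than `1`: first
  -- at the point `γ s'`, then by continuity near it.
  have hL : ContinuousAt (fun s' => ‖θ s' - logBranch γ p θ s (γ s')‖) s :=
    (hθ.continuousAt.sub (ContinuousAt.comp (f := γ) (g := logBranch γ p θ s)
      (eventually_hasDerivAt_logBranch s (hne s)).self_of_nhds.continuousAt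
      γ.continuous.continuousAt)).norm
  filter_upwards [hL.eventually_lt (continuousAt_const (y := (1 : ℝ))) (by simp [hself]),
    γ.continuous.continuousAt.eventually (eventually_hasDerivAt_logBranch (θ := θ) s (hne s))]
    with s' h1 h2
  have hc : ContinuousAt (fun z => ‖logBranch γ p θ s' z - logBranch γ p θ s z‖) (γ s') :=
    ((eventually_hasDerivAt_logBranch s' (hne s')).self_of_nhds.continuousAt.sub
      h2.continuousAt).norm
  filter_upwards [hc.eventually_lt (continuousAt_const (y := (1 : ℝ))) (by simpa [hself] using h1),
    eventually_ne_nhds (hne s')] with z hz hzp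
  exact eq_of_exp_eq_of_norm_sub_lt ((exp_logBranch he s' hzp).trans (exp_logBranch he s hzp).symm) hz

end logBranch

end DarbouxHalphen
namespace DarbouxHalphen

/-! ### The matrices `exp (g I + h S)` -/

section expPair

open scoped Matrix.Norms.Operator

variable {n : ℕ}

/-- `exp (g I + h S)`. -/
noncomputable def expPair (S : Matrix (Fin n) (Fin n) ℂ) (g h : ℂ) : Matrix (Fin n) (Fin n) ℂ :=
  Complex.exp g • NormedSpace.exp (h • S)

variable (S : Matrix (Fin n) (Fin n) ℂ)

theorem expPair_add (g h g' h' : ℂ) :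
    expPair S (g + g') (h + h') = expPair S g h * expPair S g' h' := by
  rw [expPair, expPair, expPair, Complex.exp_add, add_smul, Matrix.exp_add_of_commute,
    smul_mul_smul_comm]
  exact ((Commute.refl S).smul_left h).smul_right h'

theorem expPair_zero : expPair S 0 0 = 1 := by
  simp [expPair]

theorem isUnit_expPair (g h : ℂ) : IsUnit (expPair S g h) := by
  refine IsUnit.of_mul_eq_one (expPair S (-g) (-h)) ?_
  rw [← expPair_add, add_neg_cancel, add_neg_cancel, expPair_zero]

theorem expPair_eq_smul (g h : ℂ) : expPair S g h = Complex.exp g • expPair S 0 h := by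
  simp [expPair]

theorem commute_expPair (g h : ℂ) : Commute S (expPair S g h) :=
  (((Commute.refl S).smul_right h).exp_right).smul_right _

theorem hasDerivAt_expPair {g h : ℂ → ℂ} {g' h' z : ℂ} (hg : HasDerivAt g g' z)
    (hh : HasDerivAt h h' z) :
    HasDerivAt (fun z => expPair S (g z) (h z))
      ((g' • (1 : Matrix (Fin n) (Fin n) ℂ) + h' • S) * expPair S (g z) (h z)) z := by
  have h1 := (hasDerivAt_exp_smul_const' (𝕂 := ℂ) S (h z)).scomp z hh
  convert! hg.cexp.smul h1 using 1
  simp only [expPair, add_mul, smul_mul_assoc, one_mul, mul_smul_comm, smul_smul, Function.comp_apply]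
  rw [smul_add, smul_smul, smul_smul, add_comm]
  rfl

/-- Links the entrywise derivatives of the definitions to the normed algebra, where the product rule
and the exponential are available. -/
theorem hasDerivAt_matrix_iff {F : ℂ → Matrix (Fin n) (Fin n) ℂ} {F' : Matrix (Fin n) (Fin n) ℂ}
    {z : ℂ} : HasDerivAt F F' z ↔ ∀ j k, HasDerivAt (fun w => F w j k) (F' j k) z := by
  constructor
  · intro h j k
    have h1 := (Matrix.entryLinearMap ℂ ℂ j k).toContinuousLinearMap.hasFDerivAt.comp_hasDerivAt z h
    exact h1
  · intro h
    have h1 : HasDerivAt (fun w => ∑ j, ∑ k, F w j k • Matrix.single j k (1 : ℂ))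
        (∑ j, ∑ k, F' j k • Matrix.single j k (1 : ℂ)) z :=
      HasDerivAt.fun_sum fun j _ => HasDerivAt.fun_sum fun k _ => (h j k).smul_const _
    have h2 : ∀ M : Matrix (Fin n) (Fin n) ℂ,
        ∑ j, ∑ k, M j k • Matrix.single j k (1 : ℂ) = M := fun M => by
      conv_rhs => rw [Matrix.matrix_eq_sum_single M]
      simp [Matrix.smul_single]
    simpa only [h2] using h1

/-- Integrating factor: `expPair S (-g) (-h) * Y` has derivative zero, since `expPair` commutes with
the coefficient. -/
theorem eq_expPair_mul_of_hasDerivAt {g h g' h' : ℂ → ℂ} {Y : ℂ → Matrix (Fin n) (Fin n) ℂ}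
    {z₀ : ℂ} (hg : ∀ᶠ z in 𝓝 z₀, HasDerivAt g (g' z) z) (hh : ∀ᶠ z in 𝓝 z₀, HasDerivAt h (h' z) z)
    (hY : ∀ᶠ z in 𝓝 z₀, HasDerivAt Y ((g' z • (1 : Matrix (Fin n) (Fin n) ℂ) + h' z • S) * Y z) z) :
    Y =ᶠ[𝓝 z₀] fun z => expPair S (g z) (h z) * (expPair S (-g z₀) (-h z₀) * Y z₀) := by
  obtain ⟨ε, hε, hb⟩ := Metric.eventually_nhds_iff_ball.1 (hg.and (hh.and hY))
  have hD : ∀ z ∈ Metric.ball z₀ ε,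
      HasDerivAt (fun z => expPair S (-g z) (-h z) * Y z) 0 z := fun z hz => by
    obtain ⟨h1, h2, h3⟩ := hb z hz
    convert! (hasDerivAt_expPair S h1.neg h2.neg).mul h3 using 1
    have hc : Commute (g' z • (1 : Matrix (Fin n) (Fin n) ℂ) + h' z • S)
        (expPair S (-g z) (-h z)) :=
      ((Commute.one_left _).smul_left _).add_left ((commute_expPair S _ _).smul_left _)
    simp only [Pi.neg_apply]
    rw [← mul_assoc (expPair S _ _), ← hc.eq, neg_smul, neg_smul, ← neg_add, neg_mul, neg_mul,
      neg_add_cancel]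
  have hconst := fun z hz => Metric.isOpen_ball.is_const_of_deriv_eq_zero
    (convex_ball z₀ ε).isPreconnected
    (fun z hz => (hD z hz).differentiableAt.differentiableWithinAt) (fun z hz => (hD z hz).deriv)
    hz (Metric.mem_ball_self hε) (x := z)
  filter_upwards [Metric.ball_mem_nhds z₀ hε] with z hz
  rw [← hconst z hz, ← mul_assoc, ← expPair_add, add_neg_cancel,
    add_neg_cancel, expPair_zero, one_mul]

/-- If `Y' = B Y` with coefficients `B` commuting with `X`, then `Y⁻¹ X Y` is constant. -/
theorem conj_eq_of_hasDerivAt {U : Set ℂ} (hUo : IsOpen U) (hUc : IsPreconnected U)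
    {Y B : ℂ → Matrix (Fin n) (Fin n) ℂ} {X : Matrix (Fin n) (Fin n) ℂ}
    (hu : ∀ t ∈ U, IsUnit (Y t)) (hY : ∀ t ∈ U, HasDerivAt Y (B t * Y t) t)
    (hB : ∀ t ∈ U, Commute (B t) X) {t t' : ℂ} (ht : t ∈ U) (ht' : t' ∈ U) :
    (Y t)⁻¹ * X * Y t = (Y t')⁻¹ * X * Y t' := by
  have hD : ∀ t ∈ U, HasDerivAt (fun t => (Y t)⁻¹ * X * Y t) 0 t := fun t ht => by
    obtain ⟨u, hu'⟩ := hu t ht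
    have h1 : HasDerivAt (fun t => (Y t)⁻¹) 
        (-((↑u⁻¹ : Matrix (Fin n) (Fin n) ℂ) * (B t * Y t) * (↑u⁻¹ : Matrix (Fin n) (Fin n) ℂ))) t := by
      simp only [Matrix.nonsing_inv_eq_ringInverse]
      have h2 := hasFDerivAt_ringInverse (𝕜 := ℂ) u
      rw [hu'] at h2
      simpa using! h2.comp_hasDerivAt t (hY t ht)
    convert! (h1.mul_const X).mul (hY t ht) using 1
    rw [← hu', Matrix.nonsing_inv_eq_ringInverse, Ring.inverse_unit]
    -- The derivative is `Y⁻¹ (X B - B X) Y`.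
    have hc := (hB t ht).eq
    simp only [mul_assoc, neg_mul, Units.mul_inv, mul_one]
    rw [← mul_assoc X, ← hc, mul_assoc, neg_add_cancel]
  exact hUo.is_const_of_deriv_eq_zero hUc
    (fun z hz => (hD z hz).differentiableAt.differentiableWithinAt) (fun z hz => (hD z hz).deriv)
    ht ht'

end expPair

/-- The monodromy of a system `dY/dz = (∑ βᵢ / (z - pᵢ) I + ∑ λᵢ / (z - pᵢ) S) Y`, in terms of the
winding numbers of the loop. -/
theorem isMonodromyMatrix_of_hasWinding {n m : ℕ} {x₀ : ℂ} {p β l : Fin m → ℂ}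
    {S : Matrix (Fin n) (Fin n) ℂ} {Y : ℂ → Matrix (Fin n) (Fin n) ℂ}
    (hY : IsFundamentalSolutionNear (fun z => (∑ i, β i / (z - p i)) •
      (1 : Matrix (Fin n) (Fin n) ℂ) + (∑ i, l i / (z - p i)) • S) x₀ Y)
    {γ : Path x₀ x₀} {w : Fin m → ℤ} (hw : ∀ i, HasWinding (fun s => γ s - p i) (w i)) :
    IsMonodromyMatrix Y γ ((Y x₀)⁻¹ * expPair S (∑ i, β i * (w i * (2 * Real.pi * Complex.I)))
      (∑ i, l i * (w i * (2 * Real.pi * Complex.I))) * Y x₀) := by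
  choose θ hθ he h1 using hw
  have hne : ∀ s i, γ s ≠ p i := fun s i =>
    sub_ne_zero.1 (ne_of_eq_of_ne (he i s).symm (Complex.exp_ne_zero _))
  set g : unitInterval → ℂ → ℂ := fun s z => ∑ i, β i * logBranch γ (p i) (θ i) s z
  set h : unitInterval → ℂ → ℂ := fun s z => ∑ i, l i * logBranch γ (p i) (θ i) s z
  have hsum : ∀ (κ : Fin m → ℂ) s, ∀ᶠ z in 𝓝 (γ s),
      HasDerivAt (fun z => ∑ i, κ i * logBranch γ (p i) (θ i) s z) (∑ i, κ i / (z - p i)) z :=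
    fun κ s => by
      filter_upwards [eventually_all.2 fun i =>
        eventually_hasDerivAt_logBranch (γ := γ) (θ := θ i) s (hne s i)] with z hz
      refine HasDerivAt.fun_sum fun i _ => ?_
      simpa [div_eq_mul_inv] using (hz i).const_mul (κ i)
  have hg : ∀ s, ∀ᶠ z in 𝓝 (γ s), HasDerivAt (g s) (∑ i, β i / (z - p i)) z := hsum β
  have hh : ∀ s, ∀ᶠ z in 𝓝 (γ s), HasDerivAt (h s) (∑ i, l i / (z - p i)) z := hsum l
  obtain ⟨K, hK⟩ : ∃ K, K = expPair S (-g 0 x₀) (-h 0 x₀) * Y x₀ := ⟨_, rfl⟩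
  have hF0 : Y =ᶠ[𝓝 x₀] fun z => expPair S (g 0 z) (h 0 z) * K := by
    rw [hK]
    refine eq_expPair_mul_of_hasDerivAt S (by simpa using hg 0) (by simpa using hh 0) ?_
    exact hY.mono fun z hz => hasDerivAt_matrix_iff.2 hz.2
  refine ⟨fun s z => expPair S (g s z) (h s z) * K, ⟨fun s j k => ?_, fun s => ?_⟩, hF0.symm, ?_⟩
  · refine Complex.analyticAt_iff_eventually_differentiableAt.2 ?_
    filter_upwards [hg s, hh s] with z hz1 hz2
    have := (hasDerivAt_matrix_iff.1 (hasDerivAt_expPair S hz1 hz2))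
    simp only [Matrix.mul_apply]
    exact (HasDerivAt.fun_sum fun i _ => (this j i).mul_const (K i k)).differentiableAt
  · filter_upwards [eventually_all.2 fun i =>
      eventually_logBranch_eventuallyEq (hθ i) (he i) s] with s' hs'
    filter_upwards [eventually_all.2 hs'] with z hz
    simp only [g, h, hz]
  · filter_upwards [hF0] with z hz
    have hshift : ∀ i, logBranch γ (p i) (θ i) 1 z =
        logBranch γ (p i) (θ i) 0 z + w i * (2 * Real.pi * Complex.I) := fun i => by
      simp only [logBranch, h1, γ.source, γ.target]
      ring
    have hY0 : Y x₀ * (Y x₀)⁻¹ = 1 :=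
      Matrix.mul_nonsing_inv _ ((Matrix.isUnit_iff_isUnit_det _).1 hY.self_of_nhds.1)
    -- `K` is an `expPair` times `Y x₀`, and `expPair`s commute; so right multiplication by the
    -- claimed monodromy is a shift of `g` and `h`.
    have key : ∀ a b, K * ((Y x₀)⁻¹ * expPair S a b * Y x₀) = expPair S a b * K := fun a b => by
      rw [hK, mul_assoc, mul_assoc (Y x₀)⁻¹, ← mul_assoc (Y x₀), hY0, one_mul, ← mul_assoc,
        ← mul_assoc, ← expPair_add, ← expPair_add, add_comm, add_comm (-h 0 x₀)]
    simp only [hz]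
    rw [mul_assoc, key, ← mul_assoc, ← expPair_add]
    simp only [g, h, hshift, mul_add, Finset.sum_add_distrib]

end DarbouxHalphen
namespace DarbouxHalphen

/-! ### Residues of the Lax pair -/

/-- The residue of `1 / P` at `p i`. -/
noncomputable def cubicResidue (p : Fin 3 → ℂ) (i : Fin 3) : ℂ :=
  (p i - p (i + 1))⁻¹ * (p i - p (i + 2))⁻¹

theorem sum_fin_three_rotate {M : Type*} [AddCommMonoid M] (f : Fin 3 → M) (i : Fin 3) :
    ∑ j, f j = f i + f (i + 1) + f (i + 2) := by
  fin_cases i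
  · exact Fin.sum_univ_three f
  · rw [Fin.sum_univ_three, add_rotate]; rfl
  · rw [Fin.sum_univ_three, ← add_rotate]; rfl

theorem cubicP_rotate (p : Fin 3 → ℂ) (z : ℂ) (i : Fin 3) :
    cubicP p z = (z - p i) * (z - p (i + 1)) * (z - p (i + 2)) := by
  fin_cases i <;> simp [cubicP, Fin.prod_univ_three] <;> ring

theorem sub_ne_zero_of_injective {p : Fin 3 → ℂ} (hp : Function.Injective p) (i : Fin 3) :
    p i - p (i + 1) ≠ 0 ∧ p i - p (i + 2) ≠ 0 := by
  refine ⟨sub_ne_zero.2 (hp.ne ?_), sub_ne_zero.2 (hp.ne ?_)⟩ <;> revert i <;> decide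

theorem div_cubicP_eq_sum {p : Fin 3 → ℂ} (hp : Function.Injective p) (μ : ℂ) {z : ℂ}
    (hz : ∀ i, z ≠ p i) : μ / cubicP p z = ∑ i, μ * cubicResidue p i / (z - p i) := by
  have h01 := sub_ne_zero.2 (hp.ne (show (0 : Fin 3) ≠ 1 by decide))
  have h02 := sub_ne_zero.2 (hp.ne (show (0 : Fin 3) ≠ 2 by decide))
  have h12 := sub_ne_zero.2 (hp.ne (show (1 : Fin 3) ≠ 2 by decide))
  have h10 := sub_ne_zero.2 (hp.ne (show (1 : Fin 3) ≠ 0 by decide))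
  have h20 := sub_ne_zero.2 (hp.ne (show (2 : Fin 3) ≠ 0 by decide))
  have h21 := sub_ne_zero.2 (hp.ne (show (2 : Fin 3) ≠ 1 by decide))
  have h0 := sub_ne_zero.2 (hz 0)
  have h1 := sub_ne_zero.2 (hz 1)
  have h2 := sub_ne_zero.2 (hz 2)
  have e1 : (1 : Fin 3) + 1 = 2 := rfl
  have e2 : (1 : Fin 3) + 2 = 0 := rfl
  have e3 : (2 : Fin 3) + 1 = 0 := rfl
  have e4 : (2 : Fin 3) + 2 = 1 := rfl
  simp only [cubicP, cubicResidue, Fin.sum_univ_three, Fin.prod_univ_three, zero_add, e1, e2, e3, e4]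
  field_simp
  ring

/-- After multiplication by `z - p i` both sides extend continuously to `p i`, so they agree there
too. -/
theorem residue_eq {p α : Fin 3 → ℂ} (hp : Function.Injective p)
    (hα : ∀ z, (∀ i, z ≠ p i) → (z + ∑ i, p i) / cubicP p z = ∑ i, α i / (z - p i)) (i : Fin 3) :
    α i = (2 * p i + p (i + 1) + p (i + 2)) * cubicResidue p i := by
  obtain ⟨h1, h2⟩ := sub_ne_zero_of_injective hp i
  have hev : (fun z => (z + ∑ j, p j) * ((z - p (i + 1))⁻¹ * (z - p (i + 2))⁻¹)) =ᶠ[𝓝[≠] (p i)]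
      fun z => α i + (z - p i) * (α (i + 1) / (z - p (i + 1)) + α (i + 2) / (z - p (i + 2))) := by
    filter_upwards [self_mem_nhdsWithin,
      nhdsWithin_le_nhds (eventually_ne_nhds (sub_ne_zero.1 h1)),
      nhdsWithin_le_nhds (eventually_ne_nhds (sub_ne_zero.1 h2))] with z hz0 hz1 hz2
    have hz : ∀ j, z ≠ p j := fun j => by
      have hcases : ∀ i j : Fin 3, j = i ∨ j = i + 1 ∨ j = i + 2 := by decide
      rcases hcases i j with rfl | rfl | rfl
      exacts [hz0, hz1, hz2]
    have h := hα z hz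
    have hz0' := sub_ne_zero.2 (hz i)
    rw [cubicP_rotate p z i, sum_fin_three_rotate (fun j => α j / (z - p j)) i] at h
    calc _ = (z - p i) * ((z + ∑ j, p j) / ((z - p i) * (z - p (i + 1)) * (z - p (i + 2)))) := by
          field_simp
      _ = _ := by
          rw [h, add_assoc, mul_add, mul_div_cancel₀ _ hz0']
  have h := (ContinuousAt.eventuallyEq_nhds_iff_eventuallyEq_nhdsNE
    (by fun_prop (disch := assumption)) (by fun_prop (disch := assumption))).1 hev
  have h' := h.eq_of_nhds
  simp only [sub_self, zero_mul, add_zero] at h'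
  rw [← h', sum_fin_three_rotate p i, cubicResidue]
  ring

theorem laxA_eq {p : Fin 3 → ℂ} (hp : Function.Injective p) (μ : ℂ) (l : Fin 3 → ℂ)
    (S : Matrix (Fin 2) (Fin 2) ℂ) {z : ℂ} (hz : ∀ i, z ≠ p i) :
    laxA μ l S p z = (∑ i, μ * cubicResidue p i / (z - p i)) • (1 : Matrix (Fin 2) (Fin 2) ℂ) +
      (∑ i, l i / (z - p i)) • S := by
  rw [laxA, div_cubicP_eq_sum hp μ hz, Finset.sum_smul (s := Finset.univ) (x := S)]

theorem commute_laxA (μ : ℂ) (l : Fin 3 → ℂ) {S X : Matrix (Fin 2) (Fin 2) ℂ} (p : Fin 3 → ℂ)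
    (z : ℂ) (h : Commute S X) : Commute (laxA μ l S p z) X :=
  ((Commute.one_left X).smul_left _).add_left (Commute.sum_left _ _ _ fun _ _ => h.smul_left _)

theorem commute_laxB (ν : ℂ) (l : Fin 3 → ℂ) {S X : Matrix (Fin 2) (Fin 2) ℂ} (p : Fin 3 → ℂ)
    (h : Commute S X) : Commute (laxB ν l S p) X :=
  ((Commute.one_left X).smul_left _).add_left (Commute.sum_left _ _ _ fun _ _ => h.smul_left _)

/-- The part of `Q` independent of `z` cancels in differences: `(xᵢ - xⱼ)' = (xᵢ - xⱼ)(xᵢ + xⱼ)`.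
Logarithmic differentiation then yields the factor in `residue_eq`. -/
theorem IsHalphenSolution.hasDerivAt_cubicResidue {a b c : ℂ} {x : Fin 3 → ℂ → ℂ} {U : Set ℂ}
    (hx : IsHalphenSolution a b c x U) {t : ℂ} (ht : t ∈ U)
    (hp : Function.Injective fun j => x j t) (i : Fin 3) :
    HasDerivAt (fun t => cubicResidue (fun j => x j t) i)
      (-((2 * x i t + x (i + 1) t + x (i + 2) t) * cubicResidue (fun j => x j t) i)) t := by
  obtain ⟨h1, h2⟩ := sub_ne_zero_of_injective hp i
  convert! (((hx t ht i).sub (hx t ht (i + 1))).inv h1).mul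
    (((hx t ht i).sub (hx t ht (i + 2))).inv h2) using 1
  simp only [cubicResidue, quadQ, Pi.sub_apply, Pi.inv_apply] at h1 h2 ⊢
  field_simp
  ring

/-! ### Monodromy of the Lax solution and its dependence on time -/

namespace IsLaxFundamentalSolution

variable {a b c μ : ℂ} {l : Fin 3 → ℂ} {S : Matrix (Fin 2) (Fin 2) ℂ} {U V : Set ℂ}
  {x : Fin 3 → ℂ → ℂ} {ν : ℂ → ℂ → ℂ} {Y : ℂ → ℂ → Matrix (Fin 2) (Fin 2) ℂ} {x₀ : ℂ}

theorem isFundamentalSolutionNear (hY : IsLaxFundamentalSolution a b c μ l S x ν U V Y)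
    (hV : V ∈ 𝓝 x₀) {t : ℂ} (ht : t ∈ U) :
    IsFundamentalSolutionNear (laxA μ l S fun i => x i t) x₀ (Y t) := by
  filter_upwards [hV] with z hz using ⟨hY.isUnit t ht z hz, hY.deriv_z t ht z hz⟩

theorem conj_expPair_eq (hY : IsLaxFundamentalSolution a b c μ l S x ν U V Y)
    (hUo : IsOpen U) (hUc : IsPreconnected U) (hx₀ : x₀ ∈ V) (g h : ℂ) {t t' : ℂ}
    (ht : t ∈ U) (ht' : t' ∈ U) :
    (Y t x₀)⁻¹ * expPair S g h * Y t x₀ = (Y t' x₀)⁻¹ * expPair S g h * Y t' x₀ := by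
  -- Substituting the first Lax equation for `∂Y/∂z` in the second gives an ordinary equation in `t`
  -- at `x₀`, with this coefficient.
  refine conj_eq_of_hasDerivAt (Y := fun t => Y t x₀) (B := fun t =>
      laxB (ν t x₀) l S (fun i => x i t) -
        quadQ a b c (fun i => x i t) x₀ • laxA μ l S (fun i => x i t) x₀) hUo hUc
    (fun t ht => hY.isUnit t ht x₀ hx₀) (fun t ht => hasDerivAt_matrix_iff.2 fun j k => ?_)
    (fun t _ => ?_) ht ht'
  · convert! hY.deriv_t t ht x₀ hx₀ j k using 1
    rw [(hY.deriv_z t ht x₀ hx₀ j k).deriv, sub_mul, smul_mul_assoc]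
    simp
  · exact (commute_laxB _ _ _ (commute_expPair S g h)).sub_left
      ((commute_laxA _ _ _ _ (commute_expPair S g h)).smul_left _)

theorem isMonodromyMatrix (hY : IsLaxFundamentalSolution a b c μ l S x ν U V Y)
    (hinj : ∀ t ∈ U, Function.Injective fun i => x i t) (hV : ∀ t ∈ U, ∀ i, x i t ∉ V)
    (hUo : IsOpen U) (hUc : IsPreconnected U) (hVo : IsOpen V) (hx₀ : x₀ ∈ V)
    {t t₀ : ℂ} (ht : t ∈ U) (ht₀ : t₀ ∈ U) {γ : Path x₀ x₀} {w : Fin 3 → ℤ}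
    (hw : ∀ i, HasWinding (fun s => γ s - x i t) (w i)) :
    IsMonodromyMatrix (Y t) γ
      (Complex.exp (∑ i, μ * cubicResidue (fun j => x j t) i * (w i * (2 * Real.pi * Complex.I))) •
        ((Y t₀ x₀)⁻¹ * expPair S 0 (∑ i, l i * (w i * (2 * Real.pi * Complex.I))) * Y t₀ x₀)) := by
  have hfund := hY.isFundamentalSolutionNear (hVo.mem_nhds hx₀) ht
  have hfund' : IsFundamentalSolutionNear (fun z =>
      (∑ i, μ * cubicResidue (fun j => x j t) i / (z - x i t)) •
        (1 : Matrix (Fin 2) (Fin 2) ℂ) + (∑ i, l i / (z - x i t)) • S) x₀ (Y t) := by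
    filter_upwards [hfund, hVo.mem_nhds hx₀] with z hz hzV
    rwa [laxA_eq (hinj t ht) μ l S fun i h => hV t ht i (h ▸ hzV)] at hz
  rw [← smul_mul_assoc, ← mul_smul_comm, ← expPair_eq_smul,
    hY.conj_expPair_eq hUo hUc hx₀ _ _ ht₀ ht]
  exact isMonodromyMatrix_of_hasWinding hfund' hw

end IsLaxFundamentalSolution

theorem integral_mul_derivWithin_eq_sub {U : Set ℂ} {f f' : ℂ → ℂ}
    (hf : ∀ t ∈ U, HasDerivAt f (f' t) t) (hf' : ContinuousOn f' U) {σ : ℝ → ℂ}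
    (hσ : ContDiffOn ℝ 1 σ (Set.Icc 0 1)) (hU : ∀ s ∈ Set.Icc (0 : ℝ) 1, σ s ∈ U) :
    ∫ s in (0 : ℝ)..1, f' (σ s) * derivWithin σ (Set.Icc 0 1) s = f (σ 1) - f (σ 0) := by
  have hd : ∀ s ∈ Set.Icc (0 : ℝ) 1, HasDerivWithinAt (fun s => f (σ s))
      (f' (σ s) * derivWithin σ (Set.Icc 0 1) s) (Set.Icc 0 1) s := fun s hs => by
    have h1 := (hσ.differentiableOn one_ne_zero s hs).hasDerivWithinAt
    exact (hf _ (hU s hs)).comp_hasDerivWithinAt s h1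
  refine intervalIntegral.integral_eq_sub_of_hasDerivAt_of_le zero_le_one
    (fun s hs => (hd s hs).continuousWithinAt)
    (fun s hs => (hd s (Set.Ioo_subset_Icc_self hs)).hasDerivAt (Icc_mem_nhds hs.1 hs.2)) ?_
  refine ContinuousOn.intervalIntegrable ?_
  rw [Set.uIcc_of_le zero_le_one]
  exact (hf'.comp hσ.continuousOn hU).mul
    (hσ.continuousOn_derivWithin (uniqueDiffOn_Icc zero_lt_one) le_rfl)

end DarbouxHalphen

open DarbouxHalphen in
theorem proposition3p1
    -- constants of Halphen's second equation and of the Lax pair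
    (a b c μ : ℂ) (hab : a + b = -1 / 4) (hcb : c + b = -1 / 4) (hμ : μ ≠ 0)
    (l : Fin 3 → ℂ) (hl : ∑ i, l i = 0)
    (S : Matrix (Fin 2) (Fin 2) ℂ) (hS : S.trace = 0)
    -- the time domain and the three moving singular points
    (t₀ : ℂ) (U : Set ℂ) (hUo : IsOpen U) (hUc : IsConnected U) (ht₀ : t₀ ∈ U)
    (x : Fin 3 → ℂ → ℂ) (hx : IsHalphenSolution a b c x U)
    (hinj : ∀ t ∈ U, Function.Injective (fun i => x i t))
    -- the base point, with a neighbourhood free of singular points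
    (x₀ : ℂ) (V : Set ℂ) (hVo : IsOpen V) (hx₀ : x₀ ∈ V)
    (hV : ∀ t ∈ U, ∀ i, x i t ∉ V)
    -- the auxiliary function and the fundamental solution of the Lax pair
    (ν : ℂ → ℂ → ℂ)
    (hν : ∀ t ∈ U, ∀ z ∈ V, HasDerivAt (ν t)
      (-((z + ∑ i, x i t) / cubicP (fun i => x i t) z) * μ) z)
    (Y : ℂ → ℂ → Matrix (Fin 2) (Fin 2) ℂ)
    (hY : IsLaxFundamentalSolution a b c μ l S x ν U V Y)
    -- the residues
    (α : Fin 3 → ℂ → ℂ)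
    (hα : ∀ t ∈ U, ∀ z, (∀ i, z ≠ x i t) →
      (z + ∑ i, x i t) / cubicP (fun i => x i t) z = ∑ i, α i t / (z - x i t)) :
    (∃ (C : Fin 3 → ℂ → ℂ) (G : Fin 3 → GL (Fin 2) ℂ),
      (∀ i, AnalyticOnNhd ℂ (C i) U) ∧
      -- `C i t = exp (-2πiμ ∫ α i)`, along any `C¹` path `σ` from `t₀` to `t` in `U`
      (∀ i, ∀ t ∈ U, ∀ σ : ℝ → ℂ, ContDiffOn ℝ 1 σ (Set.Icc 0 1) →
        (∀ s ∈ Set.Icc (0 : ℝ) 1, σ s ∈ U) → σ 0 = t₀ → σ 1 = t →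
        C i t = Complex.exp (-2 * Real.pi * Complex.I * μ *
          ∫ s in (0 : ℝ)..1, α i (σ s) * derivWithin σ (Set.Icc 0 1) s)) ∧
      -- the monodromy matrix along every elementary loop around `x i t` exists and is `C i t • G i`
      (∀ i, ∀ t ∈ U, ∀ γ : Path x₀ x₀, IsElementaryLoop (fun j => x j t) i γ →
        ∀ M : Matrix (Fin 2) (Fin 2) ℂ,
          IsMonodromyMatrix (Y t) γ M ↔ M = C i t • (G i : Matrix (Fin 2) (Fin 2) ℂ))) ∧
    -- projective isomonodromy, for any finite family of loops avoiding the singular points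
    (∀ (m : ℕ) (γ : Fin m → Path x₀ x₀), (∀ k s, ∀ t ∈ U, ∀ i, γ k s ≠ x i t) →
      IsProjectivelyIsomonodromic (fun t z => laxA μ l S (fun i => x i t) z) U γ) := by
  have hcont : ∀ i, ContinuousOn (x i) U := fun i t ht => (hx t ht i).continuousAt.continuousWithinAt
  have hder : ∀ i, ∀ t ∈ U, HasDerivAt (fun t => cubicResidue (fun j => x j t) i) (-α i t) t := by
    intro i t ht
    rw [residue_eq (hinj t ht) (hα t ht) i]
    exact hx.hasDerivAt_cubicResidue ht (hinj t ht) i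
  have hβ : ∀ i, AnalyticOnNhd ℂ (fun t => cubicResidue (fun j => x j t) i) U := fun i =>
    DifferentiableOn.analyticOnNhd
      (fun t ht => (hder i t ht).differentiableAt.differentiableWithinAt) hUo
  -- `α` is given only pointwise in `t`; its continuity comes from the explicit residue formula.
  have hαc : ∀ i, ContinuousOn (fun t => -α i t) U := fun i => by
    have h : ContinuousOn (fun t => -((2 * x i t + x (i + 1) t + x (i + 2) t) *
        cubicResidue (fun j => x j t) i)) U := by
      have h0 := hcont i
      have h1 := hcont (i + 1)
      have h2 := hcont (i + 2)
      have h3 := (hβ i).continuousOn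
      fun_prop
    exact h.congr fun t ht => by rw [residue_eq (hinj t ht) (hα t ht) i]
  have hYu : IsUnit (Y t₀ x₀) := hY.isUnit t₀ ht₀ x₀ hx₀
  have hG : ∀ g h, IsUnit ((Y t₀ x₀)⁻¹ * expPair S g h * Y t₀ x₀) := fun g h =>
    (((Matrix.isUnit_nonsing_inv_iff).2 hYu).mul (isUnit_expPair S g h)).mul hYu
  constructor
  -- The scalar is normalised to `1` at `t₀`; its value there is absorbed into `G i`.
  · refine ⟨fun i t => Complex.exp (2 * Real.pi * Complex.I * μ *
        (cubicResidue (fun j => x j t) i - cubicResidue (fun j => x j t₀) i)),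
      fun i => (hG (2 * Real.pi * Complex.I * μ * cubicResidue (fun j => x j t₀) i)
        (l i * (2 * Real.pi * Complex.I))).unit, fun i => ?_, fun i t ht σ hσ hσU h0 h1 => ?_,
      fun i t ht γ hγ M => ?_⟩
    · exact (analyticOnNhd_const.mul ((hβ i).sub analyticOnNhd_const)).cexp
    · have h := integral_mul_derivWithin_eq_sub (hder i) (hαc i) hσ hσU
      simp only [neg_mul, intervalIntegral.integral_neg, h0, h1] at h
      simp only [← h]
      congr 1
      ring
    · have hM := hY.isMonodromyMatrix hinj hV hUo hUc.isPreconnected hVo hx₀ ht ht₀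
        hγ.hasWinding
      suffices hE : Complex.exp (2 * Real.pi * Complex.I * μ *
          (cubicResidue (fun j => x j t) i - cubicResidue (fun j => x j t₀) i)) •
          ((hG (2 * Real.pi * Complex.I * μ * cubicResidue (fun j => x j t₀) i)
            (l i * (2 * Real.pi * Complex.I))).unit : Matrix (Fin 2) (Fin 2) ℂ) = _ by
        rw [hE]
        exact ⟨fun h => h.unique (hY.isUnit t ht x₀ hx₀) hM, fun h => h ▸ hM⟩
      -- The winding numbers of an elementary loop are Kronecker deltas, so each sum collapses to
      -- its `i`-th term.
      simp only [Int.cast_ite, Int.cast_one, Int.cast_zero, ite_mul, one_mul, zero_mul, mul_ite,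
        mul_zero, Finset.sum_ite_eq', Finset.mem_univ, if_true, IsUnit.unit_spec]
      rw [expPair_eq_smul, mul_smul_comm, smul_mul_assoc, smul_smul, ← Complex.exp_add]
      congr 2
      ring
  · intro m γ hγ
    -- The moving point never meets the loop and `U` is connected, so one integer serves all `t`;
    -- the exponent of the `S` part is therefore constant.
    have hw : ∀ k i, ∃ n, ∀ t ∈ U, HasWinding (fun s => γ k s - x i t) n := fun k i => by
      obtain ⟨n, hn⟩ := exists_hasWinding (f := fun s => γ k s - x i t₀) (by fun_prop)
        (fun s => sub_ne_zero.2 (hγ k s t₀ ht₀ i)) (by simp)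
      have := Subtype.preconnectedSpace hUc.isPreconnected
      refine ⟨n, fun t ht => HasWinding.of_preconnected (T := U) (K := fun t s => γ k s - x i t)
        ?_ (fun t s => sub_ne_zero.2 (hγ k s t t.2 i)) (by simp) (t := ⟨t₀, ht₀⟩) hn ⟨t, ht⟩⟩
      exact ((γ k).continuous.comp continuous_snd).sub
        ((continuousOn_iff_continuous_domRestrict.1 (hcont i)).comp continuous_fst)
    choose w hw using hw
    refine ⟨fun k t => Complex.exp (∑ i, μ * cubicResidue (fun j => x j t) i *
        (w k i * (2 * Real.pi * Complex.I))),
      fun k => (hG 0 (∑ i, l i * (w k i * (2 * Real.pi * Complex.I)))).unit,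
      fun k => ⟨?_, fun t _ => Complex.exp_ne_zero _⟩, fun t ht => ⟨Y t,
        hY.isFundamentalSolutionNear (hVo.mem_nhds hx₀) ht, fun k => ?_⟩⟩
    · exact (Finset.analyticOnNhd_fun_sum _ fun i _ =>
        (analyticOnNhd_const.mul (hβ i)).mul analyticOnNhd_const).cexp
    · exact hY.isMonodromyMatrix hinj hV hUo hUc.isPreconnected hVo hx₀ ht ht₀
        fun i => hw k i t ht
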